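/- Let $n\ge 0$ and let $X,Y$ be complex anti-symmetric $n\times n$ matrices ($X^t=-X$, $Y^t=-Y$). Let $\mathbb B_n(\mathbb C)$ be the group of invertible upper-triangular complex $n\times n$ matrices, let $\mathcal A_X=\{B^tXB : B\in\mathbb B_n(\mathbb C)\}$ be the congruence $B$-orbit of $X$, and let $R(X)$ be the rank-control matrix of $X$, that is, the $n\times n$ matrix whose $(k,\ell)$ entry is the rank of the upper-left $k\times\ell$ submatrix of $X$, $1\le k,\ell\le n$; define $\mathcal A_Y$ and $R(Y)$ likewise. Then the orbit $\mathcal A_X$ is contained in the Zariski closure $\overline{\mathcal A_Y}$ of $\mathcal A_Y$ if and only if $R(X)\le R(Y)$ entrywise. In other words, the closure order on the congruence $B$-orbits of anti-symmetric matrices (where $\mathcal A_X\le\mathcal A_Y$ means $\mathcal A_X\subseteq\overline{\mathcal A_Y}$) corresponds to the entrywise order on their rank-control matrices. -/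

import Mathlib

/-- The Borel subgroup of `GL_n(ℂ)`: the invertible upper-triangular matrices. -/
def borelSubgroup (n : ℕ) : Subgroup (GL (Fin n) ℂ) where
  carrier := {B | ∀ i j : Fin n, j < i → (B : Matrix (Fin n) (Fin n) ℂ) i j = 0}
  one_mem' := fun _ _ h => Matrix.one_apply_ne h.ne'
  mul_mem' := by
    intro A B hA hB i j h
    exact Matrix.BlockTriangular.mul (b := id) (fun i j h => hA i j h) (fun i j h => hB i j h) h
  inv_mem' := by
    intro A hA i j h
    have : Invertible (A : Matrix (Fin n) (Fin n) ℂ) := Units.invertible A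
    have h2 : Matrix.BlockTriangular (A : Matrix (Fin n) (Fin n) ℂ)⁻¹ id :=
      Matrix.blockTriangular_inv_of_blockTriangular (fun i j h => hA i j h)
    rw [Matrix.coe_units_inv]
    exact h2 h

/-- The congruence B-orbit `𝒜_X = {Bᵗ X B : B upper-triangular and invertible}`. -/
def congruenceOrbit {n : ℕ} (X : Matrix (Fin n) (Fin n) ℂ) : Set (Matrix (Fin n) (Fin n) ℂ) :=
  {S | ∃ B ∈ borelSubgroup n,
    S = (B : Matrix (Fin n) (Fin n) ℂ).transpose * X * (B : Matrix (Fin n) (Fin n) ℂ)}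

/-- The entries of a matrix, as a point of affine space. -/
def matrixPoint {n : ℕ} (S : Matrix (Fin n) (Fin n) ℂ) : Fin n × Fin n → ℂ :=
  fun p => S p.1 p.2

/-- The Zariski closure of a set `V` of complex `n × n` matrices: the common zeros of all
polynomials in the `n²` matrix entries that vanish on `V`. For `V` contained in the linear (hence
closed) subspace of anti-symmetric matrices this is also the closure of `V` in that subspace. -/
def matrixZariskiClosure {n : ℕ} (V : Set (Matrix (Fin n) (Fin n) ℂ)) :
    Set (Matrix (Fin n) (Fin n) ℂ) :=
  matrixPoint ⁻¹' MvPolynomial.zeroLocus ℂ (MvPolynomial.vanishingIdeal ℂ (matrixPoint '' V))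

/-- The closure order on orbits: `O₁ ≤ O₂` when `O₁` lies in the Zariski closure of `O₂`. -/
def closureLE {n : ℕ} (O₁ O₂ : Set (Matrix (Fin n) (Fin n) ℂ)) : Prop :=
  O₁ ⊆ matrixZariskiClosure O₂

/-- The rank-control matrix: with rows and columns counted from `0`, the entry at `(k, l)` is the
rank of the upper-left `(k + 1) × (l + 1)` submatrix of `X`. -/
noncomputable def rankControl {n m : ℕ} (X : Matrix (Fin n) (Fin m) ℂ) :
    Matrix (Fin n) (Fin m) ℕ :=
  Matrix.of fun k l =>
    (X.submatrix (Fin.castLE (Nat.succ_le_of_lt k.isLt))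
      (Fin.castLE (Nat.succ_le_of_lt l.isLt))).rank

/-- The entrywise order on matrices of natural numbers. -/
def entrywiseLE {n m : ℕ} (P Q : Matrix (Fin n) (Fin m) ℕ) : Prop :=
  ∀ i j, P i j ≤ Q i j

/-! Rank control is constant on orbits, because corners of congruent matrices differ by
upper-triangular factors. If a corner of X had larger rank than the same corner of every matrix in
the orbit of Y, some determinant would vanish on that orbit but not at X
(`exists_rank_submatrix_le_of_mem_closure`). This gives one direction.

For the converse, elimination makes X and Y congruent to matrices supported on partial matchings x
and y (`exists_isSupportedOn`), whose corner ranks are the numbers `matchCount`. The counts of x are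
then at most those of y. If x and y differ, `exists_isExchange` replaces two arcs of y by two others
so that the counts drop but stay above those of x; one or both of c and d may be the dummy value n,
so an arc can also be moved or deleted. Each exchange is a limit of congruent matrices
(`IsExchange.exists_mem_closure`). Induction on the sum of the counts ends at x = y, where
anti-symmetric matrices with equal support are congruent. Limits are Euclidean, and the Euclidean
closure lies in the Zariski closure. -/

/-! ### Partial matchings and their counts -/

/-- A partial matching of `{0, …, n - 1}` without fixed points, encoded by the function sending each
vertex to its partner, or to `n` when it is unmatched. -/
def IsMatching (n : ℕ) (h : ℕ → ℕ) : Prop :=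
  (∀ i < n, h i ≤ n ∧ h i ≠ i) ∧ ∀ i < n, ∀ j < n, h i = j → h j = i

/-- The number of vertices `i ≤ k` whose partner is at most `l`. -/
def matchCount (h : ℕ → ℕ) (k l : ℕ) : ℕ :=
  ((Finset.range (k + 1)).filter fun i => h i ≤ l).card

/-- The number of vertices `i ∈ [p, k]` whose partner lies in `[p, l]`. -/
def matchCountFrom (h : ℕ → ℕ) (p k l : ℕ) : ℕ :=
  ((Finset.Icc p k).filter fun i => p ≤ h i ∧ h i ≤ l).card

/-- For a matching, the last two terms depend only on the partners of vertices below p, so they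
cancel when two matchings agree there. -/
theorem matchCount_eq_add (h : ℕ → ℕ) {p k l : ℕ} (hk : p ≤ k) (hl : p ≤ l) :
    matchCount h k l = matchCountFrom h p k l + (((Finset.range p).filter fun i => h i ≤ l).card +
      ((Finset.Icc p k).filter fun i => h i < p).card) := by
  unfold matchCount matchCountFrom
  rw [add_left_comm, ← Finset.card_union_of_disjoint, ← Finset.card_union_of_disjoint]
  · congr 1
    ext i
    simp only [Finset.mem_filter, Finset.mem_union, Finset.mem_range, Finset.mem_Icc]
    omega
  · rw [Finset.disjoint_left]
    intro i
    simp only [Finset.mem_filter, Finset.mem_union, Finset.mem_range, Finset.mem_Icc]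
    omega
  · rw [Finset.disjoint_left]
    intro i
    simp only [Finset.mem_filter, Finset.mem_Icc]
    omega

theorem matchCountFrom_mono (h : ℕ → ℕ) (p : ℕ) {k k' l l' : ℕ} (hk : k ≤ k') (hl : l ≤ l') :
    matchCountFrom h p k l ≤ matchCountFrom h p k' l' := by
  unfold matchCountFrom
  apply Finset.card_le_card
  intro i
  simp only [Finset.mem_filter, Finset.mem_Icc]
  omega

theorem matchCountFrom_comm {n : ℕ} {h : ℕ → ℕ} (hh : IsMatching n h) (p : ℕ) {k l : ℕ}
    (hk : k < n) (hl : l < n) : matchCountFrom h p k l = matchCountFrom h p l k := by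
  unfold matchCountFrom
  apply Finset.card_nbij' h h
  all_goals
    intro i
    simp only [Finset.coe_filter, Set.mem_ofPred_eq, Finset.mem_Icc]
    intro hi
    have := hh.2 i (by omega) (h i) (by omega) rfl
    omega

/-- The matching is a fixed-point-free involution of the counted set. This parity is where
anti-symmetry enters the combinatorics. -/
theorem even_matchCountFrom {n : ℕ} {h : ℕ → ℕ} (hh : IsMatching n h) (p : ℕ) {k : ℕ}
    (hk : k < n) : Even (matchCountFrom h p k k) := by
  unfold matchCountFrom
  rw [← ZMod.natCast_eq_zero_iff_even, Finset.cast_card]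
  refine Finset.sum_involution (fun i _ => h i) ?_ ?_ ?_ ?_
  · intro i _
    decide
  all_goals
    intro i hi
    simp only [Finset.mem_filter, Finset.mem_Icc] at hi ⊢
    have := hh.2 i (by omega) (h i) (by omega) rfl
    have := hh.1 i (by omega)
    omega

/-- For matchings agreeing below `p`, the counts differ as much as the counts from `p` on. -/
theorem matchCount_add_matchCountFrom_of_agree {n : ℕ} {x y : ℕ → ℕ} (hx : IsMatching n x)
    (hy : IsMatching n y) {p : ℕ} (hagree : ∀ i < p, x i = y i) {k l : ℕ} (hk : p ≤ k)
    (hl : p ≤ l) (hkn : k < n) :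
    matchCount x k l + matchCountFrom y p k l = matchCount y k l + matchCountFrom x p k l := by
  have e1 : ((Finset.range p).filter fun i => x i ≤ l) =
      (Finset.range p).filter fun i => y i ≤ l := by
    apply Finset.filter_congr
    intro i hi
    rw [hagree i (Finset.mem_range.1 hi)]
  have e2 : ((Finset.Icc p k).filter fun i => x i < p) =
      (Finset.Icc p k).filter fun i => y i < p := by
    apply Finset.filter_congr
    intro i hi
    rw [Finset.mem_Icc] at hi
    constructor
    · intro h
      have h1 := hx.2 i (by omega) (x i) (by omega) rfl
      rw [hagree _ h] at h1
      have := hy.2 _ (by omega) i (by omega) h1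
      omega
    · intro h
      have h1 := hy.2 i (by omega) (y i) (by omega) rfl
      rw [← hagree _ h] at h1
      have := hx.2 _ (by omega) i (by omega) h1
      omega
  rw [matchCount_eq_add x hk hl, matchCount_eq_add y hk hl, e1, e2]
  omega

/-- Matchings agreeing below `p` have the same order on the counts from `p` on. -/
theorem matchCountFrom_le_of_agree {n : ℕ} {x y : ℕ → ℕ} (hx : IsMatching n x)
    (hy : IsMatching n y) (hxy : ∀ k < n, ∀ l < n, matchCount x k l ≤ matchCount y k l) {p : ℕ}
    (hagree : ∀ i < p, x i = y i) {k l : ℕ} (hk : p ≤ k) (hl : p ≤ l) (hkn : k < n)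
    (hln : l ≤ n) :
    matchCountFrom x p k l ≤ matchCountFrom y p k l := by
  have key : matchCount x k l ≤ matchCount y k l := by
    rcases hln.lt_or_eq with h | rfl
    · exact hxy k hkn l h
    -- At l = n unmatched vertices count too, so y counts every vertex up to k. This case is needed
    -- because l will be `x p`, which may be n.
    · unfold matchCount
      apply Finset.card_le_card
      intro i
      simp only [Finset.mem_filter, Finset.mem_range]
      intro hi
      have := hy.1 i (by omega)
      omega
  have := matchCount_add_matchCountFrom_of_agree hx hy hagree hk hl hkn
  omega

/-! ### Exchanging two arcs -/

/-- The number of arcs lost at `(k, l)` by exchanging partners. -/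
def exchangeDefect (p a c d k l : ℕ) : ℕ :=
  (if p ≤ k ∧ k < d ∧ a ≤ l ∧ l < c then 1 else 0) +
    (if p ≤ l ∧ l < d ∧ a ≤ k ∧ k < c then 1 else 0)

/-- The arcs `p a` and `c d` can be exchanged for `p c` and `a d`; here `c` or `d` may be `n`. -/
structure IsExchange (n : ℕ) (y : ℕ → ℕ) (p a c d : ℕ) : Prop where
  p_lt_a : p < a
  a_lt_c : a < c
  c_le : c ≤ n
  p_lt_d : p < d
  d_le : d ≤ n
  d_ne_a : d ≠ a
  apply_p : y p = a
  apply_c : c < n → y c = d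
  apply_d : d < n → y d = c

/-- Let p be the first vertex where x and y differ. Both partners of p lie above p, and comparing
row p gives `y p < x p`. Take a = `y p` and let d be the first vertex after p whose y-partner c lies
in (a, `x p`]. The choice of d gives slack 1 on each rectangle of the defect, and parity raises it
to 2 where they overlap. -/
theorem exists_isExchange {n : ℕ} {x y : ℕ → ℕ} (hx : IsMatching n x)
    (hy : IsMatching n y) (hxy : ∀ k < n, ∀ l < n, matchCount x k l ≤ matchCount y k l)
    (hne : ∃ i < n, x i ≠ y i) :
    ∃ p a c d, IsExchange n y p a c d ∧
      ∀ k < n, ∀ l < n, matchCount x k l + exchangeDefect p a c d k l ≤ matchCount y k l := by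
  classical
  obtain ⟨p, ⟨hpn, hpne⟩, hmin⟩ : ∃ p, (p < n ∧ x p ≠ y p) ∧ ∀ i < p, x i = y i := by
    refine ⟨Nat.find hne, Nat.find_spec hne, fun i hi => ?_⟩
    have h1 := Nat.find_min hne hi
    have h2 := (Nat.find_spec hne).1
    by_contra h
    exact h1 ⟨by omega, h⟩
  have hap : p < y p := by
    by_contra h
    have h0 := hy.1 p hpn
    have h1 := hy.2 p hpn (y p) (by omega) rfl
    rw [← hmin _ (by omega)] at h1
    have h2 := hx.2 _ (by omega) p hpn h1
    omega
  have hbp : p < x p := by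
    by_contra h
    have h0 := hx.1 p hpn
    have h1 := hx.2 p hpn (x p) (by omega) rfl
    rw [hmin _ (by omega)] at h1
    have h2 := hy.2 _ (by omega) p hpn h1
    omega
  have hbn := (hx.1 p hpn).1
  have hu : ∀ k l, p ≤ k → p ≤ l → k < n → l ≤ n →
      matchCountFrom x p k l ≤ matchCountFrom y p k l := fun k l h1 h2 h3 h4 =>
    matchCountFrom_le_of_agree hx hy hxy hmin h1 h2 h3 h4
  have hab : y p < x p := by
    by_contra h
    have h1 := hu p (x p) le_rfl hbp.le hpn hbn
    have h2 : matchCountFrom y p p (x p) = 0 := by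
      unfold matchCountFrom
      rw [Finset.card_eq_zero, Finset.filter_eq_empty_iff]
      intro i hi
      have : i = p := by simpa using hi
      subst this
      omega
    have h3 : 0 < matchCountFrom x p p (x p) := by
      unfold matchCountFrom
      rw [Finset.card_pos]
      exact ⟨p, by simp [hbp.le]⟩
    omega
  -- the choice of `c` and `d`
  obtain ⟨c, d, hE, hcb, hD⟩ : ∃ c d, IsExchange n y p (y p) c d ∧ c ≤ x p ∧
      ∀ i, p < i → i < d → ¬ (y p < y i ∧ y i ≤ x p) := by
    by_cases hex : ∃ i, p < i ∧ i < n ∧ y p < y i ∧ y i ≤ x p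
    · obtain ⟨h1, h2, h3, h4⟩ := Nat.find_spec hex
      refine ⟨y (Nat.find hex), Nat.find hex, ⟨hap, h3, by omega, h1, h2.le, ?_, rfl, ?_, ?_⟩, h4,
        ?_⟩
      · intro h
        have := hy.2 p hpn (y p) (by omega) rfl
        rw [h, this] at h3
        omega
      · intro h
        exact hy.2 _ h2 _ h rfl
      · intro _
        rfl
      · intro i hi hid h
        exact Nat.find_min hex hid ⟨hi, by omega, h⟩
    -- With no such vertex, `x p` is either n or unmatched in y, so it can serve as c with the dummy
    -- d = n.
    · refine ⟨x p, n, ⟨hap, hab, hbn, hpn, le_rfl, by omega, rfl, ?_, by omega⟩, le_rfl,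
        fun i h1 h2 h => hex ⟨i, h1, h2, h⟩⟩
      intro hb
      by_contra hyb
      have h1 := hy.1 _ hb
      have h2 := hy.2 _ hb (y (x p)) (by omega) rfl
      have h3 := hx.2 _ hpn (x p) hb rfl
      rcases lt_trichotomy (y (x p)) p with h | h | h
      · rw [← hmin _ h] at h2
        have h4 := hx.2 _ (by omega) _ hb h2
        omega
      · rw [h] at h2
        omega
      · exact hex ⟨y (x p), h, by omega, by omega⟩
  refine ⟨p, y p, c, d, hE, ?_⟩
  have hdn := hE.d_le
  -- No vertex strictly between p and d has its y-partner in (a, `x p`], so the count is constant in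
  -- l there. The x-count still grows at `x p` because of p, which gives `hstrict`.
  have hstab : ∀ k l, p ≤ k → k < d → y p ≤ l → l ≤ x p →
      matchCountFrom y p k l = matchCountFrom y p k (x p) := by
    intro k l h1 h2 h3 h4
    unfold matchCountFrom
    congr 1
    apply Finset.filter_congr
    intro i hi
    rw [Finset.mem_Icc] at hi
    rcases hi.1.eq_or_lt with rfl | h
    · omega
    · have := hD i h (by omega)
      omega
  have hstrict : ∀ k l, p ≤ k → k < d → y p ≤ l → l < x p →
      matchCountFrom x p k l + 1 ≤ matchCountFrom y p k l := by
    intro k l h1 h2 h3 h4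
    rw [hstab k l h1 h2 h3 h4.le]
    refine le_trans ?_ (hu k (x p) h1 hbp.le (by omega) hbn)
    unfold matchCountFrom
    apply Finset.card_lt_card
    rw [Finset.ssubset_iff_of_subset]
    · refine ⟨p, ?_, ?_⟩
      · simp [h1, hbp.le]
      · simp only [Finset.mem_filter, Finset.mem_Icc]
        omega
    · intro i
      simp only [Finset.mem_filter, Finset.mem_Icc]
      omega
  -- On the diagonal both counts are even, so a difference of at least 1 is at least 2; constancy in
  -- l carries this to l ≤ k.
  have hdouble' : ∀ k l, l ≤ k → k < d → y p ≤ l → k < x p →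
      matchCountFrom x p k l + 2 ≤ matchCountFrom y p k l := by
    intro k l h1 h2 h3 h4
    have e1 := hstab k l (by omega) h2 h3 (by omega)
    have e2 := hstab k k (by omega) h2 (by omega) (by omega)
    have e3 := hstrict k k (by omega) h2 (by omega) (by omega)
    obtain ⟨r, hr⟩ := even_matchCountFrom hx p (k := k) (by omega)
    obtain ⟨s, hs⟩ := even_matchCountFrom hy p (k := k) (by omega)
    have e4 := matchCountFrom_mono x p (le_refl k) h1
    omega
  have hdouble : ∀ k l, k < d → l < d → y p ≤ l → y p ≤ k → k < x p → l < x p →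
      matchCountFrom x p k l + 2 ≤ matchCountFrom y p k l := by
    intro k l h1 h2 h3 h4 h5 h6
    rcases le_total l k with h | h
    · exact hdouble' k l h h1 h3 h5
    · rw [matchCountFrom_comm hx p (by omega) (by omega),
        matchCountFrom_comm hy p (by omega) (by omega)]
      exact hdouble' l k h h2 h4 h6
  have hdefect : ∀ k l, p ≤ k → p ≤ l → k < n → l < n →
      matchCountFrom x p k l + exchangeDefect p (y p) c d k l ≤ matchCountFrom y p k l := by
    intro k l h1 h2 h3 h4
    have g0 := hu k l h1 h2 h3 h4.le
    have g1 := hstrict k l h1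
    have g2 := hstrict l k h2
    rw [matchCountFrom_comm hx p h4 h3, matchCountFrom_comm hy p h4 h3] at g2
    have g3 := hdouble k l
    unfold exchangeDefect
    split_ifs <;> omega
  intro k hk l hl
  by_cases hkl : p ≤ k ∧ p ≤ l
  · have g1 := hdefect k l hkl.1 hkl.2 hk hl
    have g2 := matchCount_add_matchCountFrom_of_agree hx hy hmin hkl.1 hkl.2 hk
    omega
  · have := hxy k hk l hl
    have h0 : exchangeDefect p (y p) c d k l = 0 := by
      unfold exchangeDefect
      split_ifs <;> omega
    omega

/-- Exchange the arcs `p a` and `c d` for `p c` and `a d`. -/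
def exchange (y : ℕ → ℕ) (p a c d : ℕ) : ℕ → ℕ := fun i =>
  if i = p then c else if i = a then d else if i = c then p else if i = d then a else y i

theorem IsExchange.isMatching {n : ℕ} {y : ℕ → ℕ} {p a c d : ℕ} (hE : IsExchange n y p a c d)
    (hy : IsMatching n y) : IsMatching n (exchange y p a c d) := by
  obtain ⟨h1, h2, h3, h4, h5, h6, h7, h8, h9⟩ := hE
  have ha := hy.2 p (by omega) a (by omega) h7
  have hcd : c = d → c = n := by
    intro h
    by_contra hc
    exact (hy.1 c (by omega)).2 (by rw [h8 (by omega), h])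
  refine ⟨fun i hi => ?_, fun i hi j hj => ?_⟩
  · have := hy.1 i hi
    have := hy.2 i hi
    unfold exchange
    split_ifs <;> grind
  · have g1 := hy.1 i hi
    have g2 := hy.2 i hi j hj
    unfold exchange
    grind

/-- Only the rows p, a, c, d change partner. The difference of the counts is a sum of four indicator
terms, those equal to n falling outside the range. -/
theorem IsExchange.matchCount_eq {n : ℕ} {y : ℕ → ℕ} {p a c d : ℕ} (hE : IsExchange n y p a c d)
    (hy : IsMatching n y) {k l : ℕ} (hk : k < n) :
    matchCount y k l = matchCount (exchange y p a c d) k l + exchangeDefect p a c d k l := by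
  obtain ⟨h1, h2, h3, h4, h5, h6, h7, h8, h9⟩ := hE
  have ha := hy.2 p (by omega) a (by omega) h7
  have hcd : c = d → c = n := by
    intro h
    by_contra hc
    exact (hy.1 c (by omega)).2 (by rw [h8 (by omega), h])
  have key : (matchCount y k l : ℤ) - matchCount (exchange y p a c d) k l =
      ∑ i ∈ Finset.range (k + 1),
        ((if p = i then (if a ≤ l ∧ l < c then (1 : ℤ) else 0) else 0) +
        (if a = i then ((if p ≤ l then (1 : ℤ) else 0) - if d ≤ l then 1 else 0) else 0) +
        (if c = i then ((if d ≤ l then (1 : ℤ) else 0) - if p ≤ l then 1 else 0) else 0) -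
        (if d = i then (if a ≤ l ∧ l < c then (1 : ℤ) else 0) else 0)) := by
    unfold matchCount
    rw [Finset.card_filter, Finset.card_filter]
    push_cast
    rw [← Finset.sum_sub_distrib]
    apply Finset.sum_congr rfl
    intro i hi
    rw [Finset.mem_range] at hi
    unfold exchange
    by_cases e1 : i = p
    · subst e1
      simp [h7, show a ≠ i by omega, show c ≠ i by omega, show d ≠ i by omega]
      split_ifs <;> omega
    by_cases e2 : i = a
    · subst e2
      simp [ha, e1, Ne.symm e1, show c ≠ i by omega, h6]
    by_cases e3 : i = c
    · subst e3
      simp [h8 (by omega), e1, Ne.symm e1, e2, Ne.symm e2, show d ≠ i by omega]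
    by_cases e4 : i = d
    · subst e4
      simp [h9 (by omega), e1, Ne.symm e1, e2, Ne.symm e2, e3, Ne.symm e3]
      split_ifs <;> omega
    simp [e1, Ne.symm e1, e2, Ne.symm e2, e3, Ne.symm e3, e4, Ne.symm e4]
  simp only [Finset.sum_add_distrib, Finset.sum_sub_distrib, Finset.sum_ite_eq,
    Finset.mem_range] at key
  unfold exchangeDefect
  zify
  rw [← sub_eq_iff_eq_add', key]
  split_ifs <;> omega

/-! ### Ranks of matrices supported on matchings -/

/-- The nonzero entries of `X` are those at `(i, h i)`. -/
def IsSupportedOn {n : ℕ} (h : ℕ → ℕ) (X : Matrix (Fin n) (Fin n) ℂ) : Prop :=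
  ∀ i j : Fin n, X i j ≠ 0 ↔ h i = j

/-- The rank of a matrix with at most one nonzero entry in each row and column. -/
theorem rank_eq_card_of_support {K L : ℕ} (A : Matrix (Fin K) (Fin L) ℂ) (h : ℕ → ℕ)
    (hA : ∀ i j, A i j ≠ 0 ↔ h i = j) (hinj : ∀ i < K, ∀ j < K, h i = h j → h i < L → i = j) :
    A.rank = ((Finset.range K).filter fun i => h i < L).card := by
  classical
  have hspan : Submodule.span ℂ (Set.range A.row) =
      Submodule.span ℂ (Set.range
        (A.submatrix (Subtype.val : {i : Fin K // h i < L} → Fin K) id).row) := by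
    apply le_antisymm
    · rw [Submodule.span_le]
      rintro _ ⟨i, rfl⟩
      by_cases hi : h i < L
      · exact Submodule.subset_span ⟨⟨i, hi⟩, rfl⟩
      · have : A.row i = 0 := by
          ext j
          by_contra hij
          have := (hA i j).1 hij
          omega
        rw [this]
        exact Submodule.zero_mem _
    · apply Submodule.span_mono
      rintro _ ⟨i, rfl⟩
      exact ⟨i.1, rfl⟩
  have hli : LinearIndependent ℂ
      (A.submatrix (Subtype.val : {i : Fin K // h i < L} → Fin K) id).row := by
    rw [Fintype.linearIndependent_iff]
    intro g hg i
    have h1 := congrFun hg ⟨h i.1, i.2⟩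
    rw [Finset.sum_apply, Finset.sum_eq_single i] at h1
    · have h2 : A i.1 ⟨h i.1, i.2⟩ ≠ 0 := (hA _ _).2 rfl
      have h3 : g i * A i.1 ⟨h i.1, i.2⟩ = 0 := h1
      exact (mul_eq_zero.1 h3).resolve_right h2
    · intro j _ hji
      have : A j.1 ⟨h i.1, i.2⟩ = 0 := by
        by_contra hne
        have h4 := (hA _ _).1 hne
        exact hji (Subtype.ext (Fin.ext (hinj _ j.1.2 _ i.1.2 h4 j.2)))
      change g j * A j.1 ⟨h i.1, i.2⟩ = 0
      rw [this, mul_zero]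
    · simp
  rw [Matrix.rank_eq_finrank_span_row, hspan, ← Matrix.rank_eq_finrank_span_row,
    hli.rank_matrix, Fintype.card_subtype]
  refine Finset.card_bij (fun i _ => i.1) ?_ ?_ ?_
  · intro i hi
    simpa using hi
  · intro i _ j _ hij
    exact Fin.ext hij
  · intro i hi
    simp only [Finset.mem_filter, Finset.mem_range] at hi
    exact ⟨⟨i, hi.1⟩, by simpa using hi.2, rfl⟩

theorem IsSupportedOn.rankControl_eq {n : ℕ} {h : ℕ → ℕ} {X : Matrix (Fin n) (Fin n) ℂ}
    (hX : IsSupportedOn h X) (hh : IsMatching n h) (k l : Fin n) :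
    rankControl X k l = matchCount h k l := by
  unfold rankControl matchCount
  rw [Matrix.of_apply, rank_eq_card_of_support _ h]
  · simp only [Nat.lt_succ_iff]
  · intro i j
    exact hX _ _
  · intro i hi j hj hij hlt
    have h1 := hh.2 i (by omega) (h i) (by omega) rfl
    have h2 := hh.2 j (by omega) (h j) (by omega) rfl
    rw [← hij] at h2
    omega

/-- A matrix of rank `r` has an invertible `r × r` compression. -/
theorem exists_mul_mul_eq_one {m n : ℕ} (A : Matrix (Fin m) (Fin n) ℂ) :
    ∃ (P : Matrix (Fin A.rank) (Fin m) ℂ) (Q : Matrix (Fin n) (Fin A.rank) ℂ), P * A * Q = 1 := by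
  let b := Module.finBasis ℂ (LinearMap.range A.mulVecLin)
  have hq : ∀ j, ∃ q, A.mulVecLin q = b j := fun j => (b j).2
  choose q hq using hq
  let Q : Matrix (Fin n) (Fin A.rank) ℂ := Matrix.of fun i j => q j i
  have hcol : ∀ j, (A * Q).col j = b j := by
    intro j
    rw [← hq j]
    rfl
  have hinj : Function.Injective (A * Q).mulVec := by
    rw [Matrix.mulVec_injective_iff]
    have : (A * Q).col = fun j => ((b j : LinearMap.range A.mulVecLin) : Fin m → ℂ) := funext hcol
    rw [this]
    exact b.linearIndependent.map' (Submodule.subtype _) (Submodule.ker_subtype _)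
  obtain ⟨g, hg⟩ := (Matrix.toLin' (A * Q)).exists_leftInverse_of_injective
    (LinearMap.ker_eq_bot.2 hinj)
  refine ⟨LinearMap.toMatrix' g, Q, ?_⟩
  rw [Matrix.mul_assoc, ← LinearMap.toMatrix'_toLin' (A * Q), ← LinearMap.toMatrix'_comp, hg,
    LinearMap.toMatrix'_id]

/-! ### Congruence orbits and their corners -/

theorem exists_mem_borelSubgroup {n : ℕ} (B : Matrix (Fin n) (Fin n) ℂ)
    (hB : ∀ i j, j < i → B i j = 0) (hd : ∀ i, B i i ≠ 0) :
    ∃ G ∈ borelSubgroup n, (G : Matrix (Fin n) (Fin n) ℂ) = B := by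
  have hdet : B.det ≠ 0 := by
    rw [Matrix.det_of_isUpperTriangular (fun i j h => hB i j h)]
    exact Finset.prod_ne_zero_iff.2 fun i _ => hd i
  exact ⟨Matrix.GeneralLinearGroup.mkOfDetNeZero B hdet, fun i j h => hB i j h, rfl⟩

theorem mem_congruenceOrbit {n : ℕ} (X B : Matrix (Fin n) (Fin n) ℂ)
    (hB : ∀ i j, j < i → B i j = 0) (hd : ∀ i, B i i ≠ 0) :
    B.transpose * X * B ∈ congruenceOrbit X := by
  obtain ⟨G, hG, rfl⟩ := exists_mem_borelSubgroup B hB hd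
  exact ⟨G, hG, rfl⟩

theorem mem_congruenceOrbit_self {n : ℕ} (X : Matrix (Fin n) (Fin n) ℂ) :
    X ∈ congruenceOrbit X :=
  ⟨1, one_mem _, by simp⟩

theorem mem_congruenceOrbit_symm {n : ℕ} {X S : Matrix (Fin n) (Fin n) ℂ}
    (h : S ∈ congruenceOrbit X) : X ∈ congruenceOrbit S := by
  obtain ⟨B, hB, rfl⟩ := h
  refine ⟨B⁻¹, inv_mem hB, ?_⟩
  have h1 : (B : Matrix (Fin n) (Fin n) ℂ) * ((B⁻¹ : GL (Fin n) ℂ) : Matrix (Fin n) (Fin n) ℂ) = 1 :=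
    Units.mul_inv B
  have h2 : ((B⁻¹ : GL (Fin n) ℂ) : Matrix (Fin n) (Fin n) ℂ).transpose *
      (B : Matrix (Fin n) (Fin n) ℂ).transpose = 1 := by
    rw [← Matrix.transpose_mul, h1, Matrix.transpose_one]
  rw [← Matrix.mul_assoc, ← Matrix.mul_assoc, h2, Matrix.one_mul, Matrix.mul_assoc, h1,
    Matrix.mul_one]

theorem mem_congruenceOrbit_trans {n : ℕ} {X Y S : Matrix (Fin n) (Fin n) ℂ}
    (h : S ∈ congruenceOrbit X) (h' : X ∈ congruenceOrbit Y) : S ∈ congruenceOrbit Y := by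
  obtain ⟨B, hB, rfl⟩ := h
  obtain ⟨C, hC, rfl⟩ := h'
  refine ⟨C * B, mul_mem hC hB, ?_⟩
  simp only [Units.val_mul, Matrix.transpose_mul, Matrix.mul_assoc]

theorem transpose_eq_neg_of_mem_congruenceOrbit {n : ℕ} {X S : Matrix (Fin n) (Fin n) ℂ}
    (h : S ∈ congruenceOrbit X) (hX : X.transpose = -X) : S.transpose = -S := by
  obtain ⟨B, -, rfl⟩ := h
  simp [Matrix.transpose_mul, hX, Matrix.mul_assoc]

/-- The upper-left corner of a congruent matrix factors through the same corner. -/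
theorem corner_eq_of_upperTriangular {n : ℕ} (X B : Matrix (Fin n) (Fin n) ℂ)
    (hB : ∀ i j, j < i → B i j = 0) {k l : ℕ} (hk : k ≤ n) (hl : l ≤ n) :
    (B.transpose * X * B).submatrix (Fin.castLE hk) (Fin.castLE hl) =
      (B.submatrix (Fin.castLE hk) (Fin.castLE hk)).transpose *
        X.submatrix (Fin.castLE hk) (Fin.castLE hl) *
        B.submatrix (Fin.castLE hl) (Fin.castLE hl) := by
  have key : ∀ {m : ℕ} (hm : m ≤ n) (j : Fin m) (f : Fin n → ℂ),
      ∑ s, f s * B s (Fin.castLE hm j) =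
        ∑ s : Fin m, f (Fin.castLE hm s) * B (Fin.castLE hm s) (Fin.castLE hm j) := by
    intro m hm j f
    symm
    refine (Finset.sum_map Finset.univ (Fin.castLEEmb hm)
      (fun s => f s * B s (Fin.castLE hm j))).symm.trans ?_
    apply Finset.sum_subset (Finset.subset_univ _)
    intro s _ hs
    rw [hB, mul_zero]
    by_contra h
    apply hs
    rw [Finset.mem_map]
    have h' : (s : ℕ) ≤ j := by simpa [Fin.lt_def] using h
    exact ⟨⟨s, by omega⟩, Finset.mem_univ _, rfl⟩
  ext i j
  simp only [Matrix.submatrix_apply, Matrix.mul_apply, Matrix.transpose_apply]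
  rw [key hl]
  apply Finset.sum_congr rfl
  intro t _
  congr 1
  have := key hk i (fun s => X s (Fin.castLE hl t))
  simpa only [mul_comm] using this

theorem rankControl_le_of_mem_congruenceOrbit {n : ℕ} {X S : Matrix (Fin n) (Fin n) ℂ}
    (h : S ∈ congruenceOrbit X) (k l : Fin n) : rankControl S k l ≤ rankControl X k l := by
  obtain ⟨B, hB, rfl⟩ := h
  unfold rankControl
  rw [Matrix.of_apply, Matrix.of_apply, corner_eq_of_upperTriangular X _ hB]
  exact (Matrix.rank_mul_le_left _ _).trans (Matrix.rank_mul_le_right _ _)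

/-! ### Zariski and Euclidean closures -/

/-- Ranks of submatrices are lower semicontinuous in the Zariski topology. -/
theorem exists_rank_submatrix_le_of_mem_closure {n K L : ℕ} {V : Set (Matrix (Fin n) (Fin n) ℂ)}
    {X : Matrix (Fin n) (Fin n) ℂ} (hX : X ∈ matrixZariskiClosure V) (e : Fin K → Fin n)
    (e' : Fin L → Fin n) : ∃ S ∈ V, (X.submatrix e e').rank ≤ (S.submatrix e e').rank := by
  obtain ⟨P, Q, hPQ⟩ := exists_mul_mul_eq_one (X.submatrix e e')
  let U : Matrix (Fin K) (Fin L) (MvPolynomial (Fin n × Fin n) ℂ) :=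
    Matrix.of fun i j => MvPolynomial.X (e i, e' j)
  -- The determinant of the compressed generic submatrix: it is 1 at X, and vanishes wherever the
  -- submatrix has rank below that of X.
  let f : MvPolynomial (Fin n × Fin n) ℂ := Matrix.det
    ((P.map (MvPolynomial.C : ℂ → MvPolynomial (Fin n × Fin n) ℂ)) * U *
      (Q.map (MvPolynomial.C : ℂ → MvPolynomial (Fin n × Fin n) ℂ)))
  have hf : ∀ S : Matrix (Fin n) (Fin n) ℂ, MvPolynomial.aeval (matrixPoint S) f =
      (P * S.submatrix e e' * Q).det := by
    intro S
    rw [AlgHom.map_det]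
    congr 1
    ext i j
    simp [Matrix.mul_apply, U, matrixPoint]
  by_contra hcon
  push Not at hcon
  have h0 : f ∈ MvPolynomial.vanishingIdeal ℂ (matrixPoint '' V) := by
    rw [MvPolynomial.mem_vanishingIdeal_iff]
    rintro _ ⟨S, hS, rfl⟩
    rw [hf]
    by_contra hne
    have h1 := Matrix.rank_of_det_ne_zero hne
    rw [Fintype.card_fin] at h1
    have h2 := (Matrix.rank_mul_le_left (P * S.submatrix e e') Q).trans
      (Matrix.rank_mul_le_right P (S.submatrix e e'))
    have h3 := hcon S hS
    omega
  have h1 := hX f h0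
  rw [hf, hPQ, Matrix.det_one] at h1
  exact one_ne_zero h1

theorem closure_subset_matrixZariskiClosure {n : ℕ} (V : Set (Matrix (Fin n) (Fin n) ℂ)) :
    closure V ⊆ matrixZariskiClosure V := by
  intro X hX f hf
  have hc : Continuous fun S : Matrix (Fin n) (Fin n) ℂ => MvPolynomial.aeval (matrixPoint S) f := by
    have h1 : Continuous fun S : Matrix (Fin n) (Fin n) ℂ => matrixPoint S :=
      continuous_pi fun p => continuous_id.matrix_elem p.1 p.2
    simp only [MvPolynomial.aeval_eq_eval]
    exact (MvPolynomial.continuous_eval f).comp h1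
  have hsub : V ⊆ {S | MvPolynomial.aeval (matrixPoint S) f = 0} := fun S hS =>
    (MvPolynomial.mem_vanishingIdeal_iff.1 hf) _ ⟨S, hS, rfl⟩
  exact closure_minimal hsub (isClosed_eq hc continuous_const) hX

/-- Each congruence is continuous and preserves the orbit of Y, hence also its closure. -/
theorem mem_closure_congruenceOrbit_trans {n : ℕ} {X Y S : Matrix (Fin n) (Fin n) ℂ}
    (h : S ∈ closure (congruenceOrbit X)) (h' : X ∈ closure (congruenceOrbit Y)) :
    S ∈ closure (congruenceOrbit Y) := by
  refine closure_minimal ?_ isClosed_closure h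
  rintro _ ⟨B, hB, rfl⟩
  have hc : Continuous fun Z : Matrix (Fin n) (Fin n) ℂ =>
      (B : Matrix (Fin n) (Fin n) ℂ).transpose * Z * (B : Matrix (Fin n) (Fin n) ℂ) := by
    fun_prop
  refine map_mem_closure (f := fun Z : Matrix (Fin n) (Fin n) ℂ =>
    (B : Matrix (Fin n) (Fin n) ℂ).transpose * Z * (B : Matrix (Fin n) (Fin n) ℂ)) hc h' ?_
  intro Z hZ
  exact mem_congruenceOrbit_trans ⟨B, hB, rfl⟩ hZ

/-! ### Elementary congruences and diagonal limits -/

theorem apply_swap_of_skew {n : ℕ} {X : Matrix (Fin n) (Fin n) ℂ} (hX : X.transpose = -X)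
    (i j : Fin n) : X i j = -X j i :=
  congrFun (congrFun hX j) i

theorem apply_self_of_skew {n : ℕ} {X : Matrix (Fin n) (Fin n) ℂ} (hX : X.transpose = -X)
    (i : Fin n) : X i i = 0 :=
  CharZero.eq_neg_self_iff.1 (apply_swap_of_skew hX i i)

/-- Adding multiples of the `a`-th basis vector to later ones. -/
theorem add_row_col_mem_congruenceOrbit {n : ℕ} {X : Matrix (Fin n) (Fin n) ℂ}
    (hX : X.transpose = -X) (a : Fin n) (v : Fin n → ℂ) (hv : ∀ j ≤ a, v j = 0) :
    (Matrix.of fun i j => X i j + v i * X a j + v j * X i a) ∈ congruenceOrbit X := by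
  have h := mem_congruenceOrbit X
    (Matrix.of fun i j => (if i = j then 1 else 0) + if i = a then v j else 0) ?_ ?_
  · convert h using 1
    ext i j
    -- The quadratic term `v i * v j * X a a` vanishes because the diagonal is zero.
    simp only [Matrix.mul_apply, Matrix.transpose_apply, Matrix.of_apply, add_mul, mul_add,
      Finset.sum_add_distrib, ite_mul, mul_ite, one_mul, mul_one, zero_mul, mul_zero,
      Finset.sum_ite_eq', Finset.mem_univ, if_true, apply_self_of_skew hX]
    ring
  · intro i j hji
    rw [Matrix.of_apply, if_neg hji.ne']
    split_ifs with h
    · rw [hv j (h ▸ hji.le), add_zero]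
    · simp
  · intro i
    rw [Matrix.of_apply, if_pos rfl]
    split_ifs with h
    · simp [hv i h.le]
    · simp

theorem diagonal_mem_congruenceOrbit {n : ℕ} (X : Matrix (Fin n) (Fin n) ℂ) (D : Fin n → ℂ)
    (hD : ∀ i, D i ≠ 0) : (Matrix.of fun i j => D i * X i j * D j) ∈ congruenceOrbit X := by
  have h := mem_congruenceOrbit X (Matrix.diagonal D)
    (fun i j h => Matrix.diagonal_apply_ne _ h.ne') (fun i => by simpa using hD i)
  convert h using 1
  ext i j
  simp [Matrix.diagonal_transpose, Matrix.mul_diagonal, Matrix.diagonal_mul]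

/-- The limit of a matrix under a one-parameter group of diagonal matrices. -/
theorem weight_limit_mem_closure {n : ℕ} (X : Matrix (Fin n) (Fin n) ℂ) (m : Fin n → ℤ)
    (hm : ∀ i j, X i j ≠ 0 → 0 ≤ m i + m j) :
    (Matrix.of fun i j => if m i + m j = 0 then X i j else 0) ∈ closure (congruenceOrbit X) := by
  refine mem_closure_of_tendsto (b := nhdsWithin (0 : ℂ) {0}ᶜ)
    (f := fun t : ℂ => Matrix.of fun i j => t ^ m i * X i j * t ^ m j) ?_ ?_
  · refine tendsto_pi_nhds.2 fun i => tendsto_pi_nhds.2 fun j => ?_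
    simp only [Matrix.of_apply]
    by_cases h0 : X i j = 0
    · simp [h0]
    obtain ⟨r, hr⟩ := Int.eq_ofNat_of_zero_le (hm i j h0)
    have h1 : Filter.Tendsto (fun t : ℂ => t ^ r * X i j) (nhdsWithin (0 : ℂ) {0}ᶜ)
        (nhds ((0 : ℂ) ^ r * X i j)) := by
      have : Continuous fun t : ℂ => t ^ r * X i j := by fun_prop
      exact (this.tendsto 0).mono_left nhdsWithin_le_nhds
    have h2 : (if m i + m j = 0 then X i j else 0) = (0 : ℂ) ^ r * X i j := by
      rw [hr]
      rcases Nat.eq_zero_or_pos r with rfl | h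
      · simp
      · simp [h.ne']
    rw [h2]
    refine h1.congr' ?_
    filter_upwards [self_mem_nhdsWithin] with t ht
    rw [mul_right_comm, ← zpow_add₀ ht, hr]
    simp
  · filter_upwards [self_mem_nhdsWithin] with t ht
    exact diagonal_mem_congruenceOrbit X _ fun i => zpow_ne_zero _ ht

theorem IsSupportedOn.apply_eq_zero {n : ℕ} {h : ℕ → ℕ} {X : Matrix (Fin n) (Fin n) ℂ}
    (hX : IsSupportedOn h X) {i j : Fin n} (hij : h i ≠ j) : X i j = 0 := by
  by_contra hne
  exact hij ((hX i j).1 hne)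

/-- Anti-symmetric matrices supported on the same matching are congruent. -/
theorem IsSupportedOn.mem_congruenceOrbit {n : ℕ} {h : ℕ → ℕ} {X X' : Matrix (Fin n) (Fin n) ℂ}
    (hh : IsMatching n h) (hX : IsSupportedOn h X) (hX' : IsSupportedOn h X')
    (hsX : X.transpose = -X) (hsX' : X'.transpose = -X') : X' ∈ congruenceOrbit X := by
  classical
  -- Only the smaller end of each arc is rescaled, by the ratio of the two entries.
  let D : Fin n → ℂ := fun i => if hi : (i : ℕ) < h i ∧ h i < n then
    X' i ⟨h i, hi.2⟩ / X i ⟨h i, hi.2⟩ else 1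
  have hD1 : ∀ i j : Fin n, h i = j → i < j → D i = X' i j / X i j := by
    intro i j hij hlt
    have e : j = ⟨h i, by omega⟩ := Fin.ext hij.symm
    have hc : (i : ℕ) < h i ∧ h i < n := by
      rw [hij]
      exact ⟨hlt, j.2⟩
    simp only [D]
    rw [dif_pos hc, ← e]
  have hD2 : ∀ i j : Fin n, h i = j → j < i → D i = 1 := by
    intro i j hij hlt
    simp only [D]
    rw [dif_neg]
    rw [hij]
    intro hc
    exact absurd hc.1 (not_lt.2 (Fin.lt_def.1 hlt).le)
  have hD : ∀ i, D i ≠ 0 := by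
    intro i
    simp only [D]
    split_ifs with hi
    · exact div_ne_zero ((hX' _ _).2 rfl) ((hX _ _).2 rfl)
    · exact one_ne_zero
  convert diagonal_mem_congruenceOrbit X D hD using 1
  ext i j
  rw [Matrix.of_apply]
  by_cases hij : h i = j
  · have hji := hh.2 i i.2 j j.2 hij
    have h1 : X i j ≠ 0 := (hX i j).2 hij
    have h2 : X j i ≠ 0 := (hX j i).2 hji
    rcases lt_trichotomy i j with hlt | rfl | hlt
    · rw [hD1 i j hij hlt, hD2 j i hji hlt]
      field_simp
    · exact absurd hij (hh.1 i i.2).2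
    · rw [hD1 j i hji hlt, hD2 i j hij hlt, apply_swap_of_skew hsX i j,
        apply_swap_of_skew hsX' i j]
      field_simp
  · rw [hX.apply_eq_zero hij, hX'.apply_eq_zero hij]
    simp

/-! ### Arc exchanges as degenerations -/

/-- An exchange of arcs up to rescaling: after two additions of basis vectors, the entries are those
of the exchanged matching, apart from the entries at `p a` and `a p`. -/
theorem IsExchange.exists_mem_congruenceOrbit {n : ℕ} {y : ℕ → ℕ} {p a : Fin n} {c d : ℕ}
    (hE : IsExchange n y p a c d) (hy : IsMatching n y) {Y : Matrix (Fin n) (Fin n) ℂ}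
    (hY : IsSupportedOn y Y) (hsY : Y.transpose = -Y) :
    ∃ S ∈ congruenceOrbit Y,
      (∀ i j : Fin n, (i : ℕ) = c → j ≠ p → S i j = 0) ∧
      (∀ j : Fin n, (j : ℕ) = c → S p j ≠ 0) ∧
      (∀ i j : Fin n, (i : ℕ) = d → j ≠ p → (j : ℕ) ≠ c → (S i j ≠ 0 ↔ a = j)) ∧
      ∀ i j : Fin n, (i : ℕ) ≠ c → (j : ℕ) ≠ c → (i : ℕ) ≠ d → (j : ℕ) ≠ d → S i j = Y i j := by
  obtain ⟨h1, h2, h3, h4, h5, h6, h7, h8, h9⟩ := hE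
  have hya := hy.2 p (by omega) a (by omega) h7
  have hcd : c = d → c = n := by
    intro h
    by_contra hc
    exact (hy.1 c (by omega)).2 (by rw [h8 (by omega), h])
  have hpa : Y p a ≠ 0 := (hY p a).2 h7
  -- Adding e_a to e_c creates an entry at (p, c). Adding ε e_p to e_d then creates one at (d, a),
  -- and ε is chosen to cancel the entry at (d, c). If c or d is n, there is nothing to cancel and ε
  -- = 1 works.
  obtain ⟨ε, hε, hε'⟩ : ∃ ε : ℂ, ε ≠ 0 ∧
      ∀ i j : Fin n, (i : ℕ) = d → (j : ℕ) = c → Y i j + ε * Y p a = 0 := by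
    by_cases hn : c < n ∧ d < n
    · have hne : Y ⟨d, hn.2⟩ ⟨c, hn.1⟩ ≠ 0 := (hY _ _).2 (h9 hn.2)
      refine ⟨-Y ⟨d, hn.2⟩ ⟨c, hn.1⟩ / Y p a, div_ne_zero (neg_ne_zero.2 hne) hpa, ?_⟩
      rintro ⟨i, hi⟩ ⟨j, hj⟩ rfl rfl
      field_simp
      ring
    · refine ⟨1, one_ne_zero, fun i j hi hj => absurd ?_ hn⟩
      omega
  let v : Fin n → ℂ := fun j => if (j : ℕ) = c then 1 else 0
  let w : Fin n → ℂ := fun j => if (j : ℕ) = d then ε else 0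
  let Y1 : Matrix (Fin n) (Fin n) ℂ :=
    Matrix.of fun i j => Y i j + v i * Y a j + v j * Y i a
  have hY1m : Y1 ∈ congruenceOrbit Y := by
    apply add_row_col_mem_congruenceOrbit hsY
    intro j hj
    have : (j : ℕ) ≤ a := hj
    simp only [v]
    rw [if_neg (by omega)]
  have hsY1 := transpose_eq_neg_of_mem_congruenceOrbit hY1m hsY
  let Y2 : Matrix (Fin n) (Fin n) ℂ :=
    Matrix.of fun i j => Y1 i j + w i * Y1 p j + w j * Y1 i p
  have hY2m : Y2 ∈ congruenceOrbit Y1 := by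
    apply add_row_col_mem_congruenceOrbit hsY1
    intro j hj
    have : (j : ℕ) ≤ p := hj
    simp only [w]
    rw [if_neg (by omega)]
  have vp : v p = 0 := if_neg (by omega)
  have formula : ∀ i j, Y2 i j = Y i j + v i * Y a j + v j * Y i a +
      w i * (Y p j + v j * Y p a) + w j * (Y i p + v i * Y a p) := by
    intro i j
    simp only [Y2, Y1, Matrix.of_apply, vp]
    ring
  have z : ∀ {i j : Fin n}, y i ≠ j → Y i j = 0 := fun h => hY.apply_eq_zero h
  refine ⟨Y2, mem_congruenceOrbit_trans hY2m hY1m, ?_, ?_, ?_, ?_⟩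
  · intro i j hi hj
    have hj' : (j : ℕ) ≠ p := fun h => hj (Fin.ext h)
    have e0 := h8 (by omega)
    have e1 : Y a j = 0 := z (by omega)
    have e2 : Y i a = 0 := z (by rw [hi]; omega)
    have e3 : w i = 0 := if_neg (by omega)
    have e4 : Y i p = 0 := z (by rw [hi]; omega)
    have e5 : v i = 1 := if_pos hi
    rw [formula, e1, e2, e3, e4, e5]
    by_cases hjd : (j : ℕ) = d
    · have e6 : w j = ε := if_pos hjd
      have := hε' j i hjd hi
      rw [e6, apply_swap_of_skew hsY i j, apply_swap_of_skew hsY a p]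
      linear_combination -this
    · have e6 : w j = 0 := if_neg hjd
      rw [e6, z (by rw [hi]; omega)]
      ring
  · intro j hj
    have e1 : Y p j = 0 := z (by omega)
    have e2 : w p = 0 := if_neg (by omega)
    have e3 : w j = 0 := if_neg (by omega)
    have e4 : v j = 1 := if_pos hj
    rw [formula, e1, e2, e3, e4, vp]
    simpa using hpa
  · intro i j hi hj hjc
    have e0 := h9 (by omega)
    have e1 : Y i j = 0 := z (by rw [hi]; omega)
    have e2 : v i = 0 := if_neg (by omega)
    have e3 : v j = 0 := if_neg hjc
    have e4 : Y i p = 0 := z (by rw [hi]; omega)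
    have e5 : w i = ε := if_pos hi
    rw [formula, e1, e2, e3, e4, e5]
    have := hY p j
    rw [h7, ← Fin.ext_iff] at this
    rw [← this]
    simp [hε]
  · intro i j hi hj hi' hj'
    have e2 : v i = 0 := if_neg hi
    have e3 : v j = 0 := if_neg hj
    have e4 : w i = 0 := if_neg hi'
    have e5 : w j = 0 := if_neg hj'
    rw [formula, e2, e3, e4, e5]
    ring

/-- Exchanging arcs is a degeneration of matrices. -/
theorem IsExchange.exists_mem_closure {n : ℕ} {y : ℕ → ℕ} {p a c d : ℕ}
    (hE : IsExchange n y p a c d) (hy : IsMatching n y) {Y : Matrix (Fin n) (Fin n) ℂ}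
    (hY : IsSupportedOn y Y) (hsY : Y.transpose = -Y) :
    ∃ Y', Y'.transpose = -Y' ∧ IsSupportedOn (exchange y p a c d) Y' ∧
      Y' ∈ closure (congruenceOrbit Y) := by
  have hM := hE.isMatching hy
  obtain ⟨p, rfl⟩ : ∃ p' : Fin n, (p' : ℕ) = p :=
    ⟨⟨p, hE.p_lt_d.trans_le hE.d_le⟩, rfl⟩
  obtain ⟨a, rfl⟩ : ∃ a' : Fin n, (a' : ℕ) = a := ⟨⟨a, hE.a_lt_c.trans_le hE.c_le⟩, rfl⟩
  obtain ⟨Y2, hY2m, row_c, entry_pc, row_d, row_other⟩ := hE.exists_mem_congruenceOrbit hy hY hsY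
  have hsY2 := transpose_eq_neg_of_mem_congruenceOrbit hY2m hsY
  obtain ⟨h1, h2, h3, h4, h5, h6, h7, h8, h9⟩ := hE
  have hya := hy.2 p (by omega) a (by omega) h7
  have hcd : c = d → c = n := by
    intro h
    by_contra hc
    exact (hy.1 c (by omega)).2 (by rw [h8 (by omega), h])
  -- Weight 1 at p and -1 at c keeps (p, c) and kills the rest of row p, notably (p, a). No entry
  -- has negative weight, since row c is zero outside column p.
  obtain ⟨m, hm⟩ : ∃ m : Fin n → ℤ,
      ∀ i, m i = if i = p then 1 else if (i : ℕ) = c then -1 else 0 := ⟨_, fun _ => rfl⟩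
  obtain ⟨Y3, hY3, hweight⟩ : ∃ Y3 : Matrix (Fin n) (Fin n) ℂ,
      (∀ i j, Y3 i j = if m i + m j = 0 then Y2 i j else 0) ∧ Y3 ∈ closure (congruenceOrbit Y2) := by
    refine ⟨_, fun _ _ => rfl, weight_limit_mem_closure Y2 m ?_⟩
    intro i j hij
    have hi : (i : ℕ) = c → j = p := fun hi => by
      by_contra hj
      exact hij (row_c i j hi hj)
    have hj : (j : ℕ) = c → i = p := fun hj => by
      by_contra hi
      rw [apply_swap_of_skew hsY2, neg_ne_zero] at hij
      exact hij (row_c j i hj hi)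
    rw [hm, hm]
    by_cases hip : i = p <;> by_cases hjp : j = p <;> by_cases hic : (i : ℕ) = c <;>
      by_cases hjc : (j : ℕ) = c <;> simp [hip, hjp, hic, hjc] <;> tauto
  have hsY3 : Y3.transpose = -Y3 := by
    ext i j
    simp only [hY3, Matrix.transpose_apply, Matrix.neg_apply, add_comm (m j)]
    split_ifs
    · exact apply_swap_of_skew hsY2 j i
    · simp
  have mp : m p = 1 := by rw [hm, if_pos rfl]
  have mc : ∀ i : Fin n, (i : ℕ) = c → m i = -1 := by
    intro i hi
    rw [hm, if_neg (fun h => by rw [h] at hi; omega), if_pos hi]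
  have m0 : ∀ i : Fin n, i ≠ p → (i : ℕ) ≠ c → m i = 0 := by
    intro i hi hi'
    rw [hm, if_neg hi, if_neg hi']
  refine ⟨Y3, hsY3, ?_, mem_closure_congruenceOrbit_trans hweight
    (subset_closure hY2m)⟩
  -- the support of the limit, first for rows at which the exchange is explicit
  have hexp : exchange y p a c d p = c := by simp [exchange]
  have hsym : ∀ i j : Fin n, (Y3 j i ≠ 0 ↔ exchange y p a c d j = i) →
      (Y3 i j ≠ 0 ↔ exchange y p a c d i = j) := by
    intro i j h
    rw [apply_swap_of_skew hsY3, neg_ne_zero, h]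
    exact ⟨fun h => hM.2 j j.2 i i.2 h, fun h => hM.2 i i.2 j j.2 h⟩
  have case_p : ∀ j : Fin n, Y3 p j ≠ 0 ↔ exchange y p a c d p = j := by
    intro j
    rw [hexp]
    simp only [hY3, mp]
    by_cases hj : (j : ℕ) = c
    · rw [mc j hj]
      simp [entry_pc j hj, hj]
    · have : ¬ (1 + m j = 0) := by
        by_cases hjp : j = p
        · rw [hjp, mp]; norm_num
        · rw [m0 j hjp hj]; norm_num
      rw [if_neg this]
      simp [Ne.symm hj]
  have case_c : ∀ i j : Fin n, (i : ℕ) = c → (Y3 i j ≠ 0 ↔ exchange y p a c d i = j) := by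
    intro i j hi
    by_cases hj : j = p
    · rw [hj]
      exact hsym i p (case_p i)
    · have : Y3 i j = 0 := by
        simp only [hY3]
        rw [row_c i j hi hj, ite_self]
      have hx : exchange y p a c d i = p := by
        unfold exchange
        rw [hi, if_neg (by omega), if_neg (by omega), if_pos rfl]
      rw [this, hx]
      exact ⟨fun h => absurd rfl h, fun h => absurd (Fin.ext h.symm) hj⟩
  have case_d : ∀ i j : Fin n, (i : ℕ) = d → (Y3 i j ≠ 0 ↔ exchange y p a c d i = j) := by
    intro i j hi
    by_cases hj : j = p
    · rw [hj]
      exact hsym i p (case_p i)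
    by_cases hjc : (j : ℕ) = c
    · exact hsym i j (case_c j i hjc)
    have hx : exchange y p a c d i = a := by
      unfold exchange
      rw [hi, if_neg (by omega), if_neg (by omega), if_neg (by omega), if_pos rfl]
    rw [hx, ← Fin.ext_iff, ← row_d i j hi hj hjc]
    simp only [hY3]
    rw [m0 i (fun h => by rw [h] at hi; omega) (by omega), m0 j hj hjc]
    simp
  intro i j
  by_cases hip : i = p
  · rw [hip]
    exact case_p j
  by_cases hic : (i : ℕ) = c
  · exact case_c i j hic
  by_cases hid : (i : ℕ) = d
  · exact case_d i j hid
  apply hsym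
  by_cases hjp : j = p
  · rw [hjp]
    exact case_p i
  by_cases hjc : (j : ℕ) = c
  · exact case_c j i hjc
  by_cases hjd : (j : ℕ) = d
  · exact case_d j i hjd
  simp only [hY3]
  rw [m0 i hip hic, m0 j hjp hjc, add_zero, if_pos rfl, row_other j i hjc hic hjd hid, hY j i]
  have hjp' : (j : ℕ) ≠ p := fun h => hjp (Fin.ext h)
  have hip' : (i : ℕ) ≠ p := fun h => hip (Fin.ext h)
  unfold exchange
  rw [if_neg hjp']
  by_cases hja : (j : ℕ) = a
  · rw [if_pos hja, hja, hya]
    omega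
  · rw [if_neg hja, if_neg hjc, if_neg hjd]

/-! ### Reduction to a matching by elimination -/

/-- Row `q` has at most one nonzero entry, and so has the column of that entry. -/
def IsCleanRow {n : ℕ} (X : Matrix (Fin n) (Fin n) ℂ) (q : Fin n) : Prop :=
  (∀ j j', X q j ≠ 0 → X q j' ≠ 0 → j = j') ∧ ∀ i j, X q j ≠ 0 → X i j ≠ 0 → i = q

/-- The first nonzero entry of row p, at column a > p, serves as pivot: column a clears the rest of
row p, then row p clears column a. Both operations add a basis vector to later ones only, and leave
the rows above p unchanged. -/
theorem exists_isCleanRow_of_forall_lt {n : ℕ} {X : Matrix (Fin n) (Fin n) ℂ}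
    (hX : X.transpose = -X) (p : Fin n) (hclean : ∀ q < p, IsCleanRow X q) :
    ∃ S ∈ congruenceOrbit X, ∀ q ≤ p, IsCleanRow S q := by
  by_cases hp : IsCleanRow X p
  · exact ⟨X, mem_congruenceOrbit_self X, fun q hq => hq.eq_or_lt.elim (fun h => h ▸ hp) (hclean q)⟩
  have swap : ∀ {i j}, X i j ≠ 0 → X j i ≠ 0 := fun {i j} h => by
    rwa [apply_swap_of_skew hX, neg_ne_zero]
  -- A nonzero entry at (p, q) with q < p would, by anti-symmetry and cleanness of row q, make row p
  -- clean already.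
  have hlt : ∀ q < p, X p q = 0 := by
    intro q hq
    by_contra hne
    have hq' := hclean q hq
    refine hp ⟨fun j j' h h' => ?_, fun i j h h' => ?_⟩
    · rw [hq'.2 j p (swap hne) (swap h), hq'.2 j' p (swap hne) (swap h')]
    · rw [hq'.2 j p (swap hne) (swap h)] at h'
      exact hq'.1 i p (swap h') (swap hne)
  have hex : ∃ a, X p a ≠ 0 := by
    by_contra hcon
    push Not at hcon
    exact hp ⟨fun j _ h => absurd (hcon j) h, fun _ j h => absurd (hcon j) h⟩
  obtain ⟨a, ha, hmin⟩ : ∃ a, X p a ≠ 0 ∧ ∀ j < a, X p j = 0 := by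
    obtain ⟨a, ha, hmin⟩ := WellFounded.has_min (wellFounded_lt (α := Fin n)) {a | X p a ≠ 0} hex
    exact ⟨a, ha, fun j hj => by
      by_contra hne
      exact hmin j hne hj⟩
  have hpa : p < a := by
    rcases lt_trichotomy p a with h | h | h
    · exact h
    · rw [← h] at ha
      exact absurd (apply_self_of_skew hX p) ha
    · exact absurd (hlt a h) ha
  have hqa : ∀ q < p, X q a = 0 := by
    intro q hq
    by_contra hne
    exact hq.ne' ((hclean q hq).2 p a hne ha)
  set v : Fin n → ℂ := fun j => if a < j then -X p j / X p a else 0 with hv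
  have v0 : ∀ j ≤ a, v j = 0 := fun j hj => if_neg (not_lt.2 hj)
  set X1 : Matrix (Fin n) (Fin n) ℂ :=
    Matrix.of fun i j => X i j + v i * X a j + v j * X i a with hX1
  have hX1m : X1 ∈ congruenceOrbit X := add_row_col_mem_congruenceOrbit hX a v v0
  have hsX1 := transpose_eq_neg_of_mem_congruenceOrbit hX1m hX
  have f1 : ∀ i j, X1 i j = X i j + v i * X a j + v j * X i a := fun _ _ => rfl
  have row1p : ∀ j, j ≠ a → X1 p j = 0 := by
    intro j hj
    rw [f1, v0 p hpa.le]
    rcases hj.lt_or_gt with h | h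
    · rw [hmin j h, v0 j h.le]
      ring
    · have : v j = -X p j / X p a := if_pos h
      rw [this]
      field_simp
      ring
  have row1pa : X1 p a ≠ 0 := by
    rw [f1, v0 p hpa.le, v0 a le_rfl]
    simpa using ha
  have row1q : ∀ q < p, ∀ j, X1 q j = X q j := by
    intro q hq j
    rw [f1, v0 q (hq.trans hpa).le, hqa q hq]
    ring
  set w : Fin n → ℂ := fun i => if p < i then -X1 i a / X1 p a else 0 with hw
  have w0 : ∀ j ≤ p, w j = 0 := fun j hj => if_neg (not_lt.2 hj)
  set X2 : Matrix (Fin n) (Fin n) ℂ :=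
    Matrix.of fun i j => X1 i j + w i * X1 p j + w j * X1 i p with hX2
  have hX2m : X2 ∈ congruenceOrbit X1 := add_row_col_mem_congruenceOrbit hsX1 p w w0
  have f2 : ∀ i j, X2 i j = X1 i j + w i * X1 p j + w j * X1 i p := fun _ _ => rfl
  have row2q : ∀ q < p, ∀ j, X2 q j = X q j := by
    intro q hq j
    rw [f2, w0 q hq.le, row1q q hq, row1q q hq, apply_swap_of_skew hX q p, hlt q hq]
    ring
  have row2p : ∀ j, j ≠ a → X2 p j = 0 := by
    intro j hj
    rw [f2, w0 p le_rfl, row1p j hj, apply_self_of_skew hsX1]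
    ring
  have wa : w a = 0 := by
    simp only [hw]
    rw [apply_self_of_skew hsX1]
    simp
  have col2a : ∀ i, i ≠ p → X2 i a = 0 := by
    intro i hi
    rcases hi.lt_or_gt with h | h
    · rw [row2q i h, hqa i h]
    · have : w i = -X1 i a / X1 p a := if_pos h
      rw [f2, wa, this]
      field_simp
      ring
  refine ⟨X2, mem_congruenceOrbit_trans hX2m hX1m, fun q hq => ?_⟩
  rcases hq.eq_or_lt with rfl | hq
  · have h : ∀ j, X2 q j ≠ 0 → j = a := fun j hj => by
      by_contra hne
      exact hj (row2p j hne)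
    refine ⟨fun j j' hj hj' => (h j hj).trans (h j' hj').symm, fun i j hj hij => ?_⟩
    rw [h j hj] at hij
    by_contra hne
    exact hij (col2a i hne)
  · refine ⟨fun j j' hj hj' => ?_, fun i j hj hij => ?_⟩
    · rw [row2q q hq] at hj hj'
      exact (hclean q hq).1 j j' hj hj'
    · rw [row2q q hq] at hj
      by_contra hne
      have z : ∀ i, i ≠ q → X i j = 0 := fun i hi => by
        by_contra h
        exact hi ((hclean q hq).2 i j hj h)
      have vj : v j = 0 := by
        simp only [hv]
        rw [z p hq.ne']
        simp
      have z1 : ∀ i, i ≠ q → X1 i j = 0 := fun i hi => by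
        rw [f1, z i hi, z a (hq.trans hpa).ne', vj]
        ring
      have wj : w j = 0 := by
        simp only [hw]
        rw [apply_swap_of_skew hsX1, z1 a (hq.trans hpa).ne']
        simp
      apply hij
      rw [f2, z1 i hne, z1 p hq.ne', wj]
      ring

theorem exists_forall_isCleanRow {n : ℕ} {X : Matrix (Fin n) (Fin n) ℂ}
    (hX : X.transpose = -X) : ∃ S ∈ congruenceOrbit X, ∀ q, IsCleanRow S q := by
  have key : ∀ m ≤ n, ∃ S ∈ congruenceOrbit X, ∀ q : Fin n, (q : ℕ) < m → IsCleanRow S q := by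
    intro m
    induction m with
    | zero => exact fun _ => ⟨X, mem_congruenceOrbit_self X, fun q hq => absurd hq (by omega)⟩
    | succ m ih =>
      intro hm
      obtain ⟨S, hS, hc⟩ := ih (by omega)
      obtain ⟨S', hS', hc'⟩ := exists_isCleanRow_of_forall_lt
        (transpose_eq_neg_of_mem_congruenceOrbit hS hX) ⟨m, hm⟩ (fun q hq => hc q hq)
      exact ⟨S', mem_congruenceOrbit_trans hS' hS, fun q hq => hc' q (Nat.lt_succ_iff.1 hq)⟩
  obtain ⟨S, hS, hc⟩ := key n le_rfl
  exact ⟨S, hS, fun q => hc q q.2⟩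

/-- Every anti-symmetric matrix is congruent to one supported on a matching. -/
theorem exists_isSupportedOn {n : ℕ} {X : Matrix (Fin n) (Fin n) ℂ} (hX : X.transpose = -X) :
    ∃ h S, IsMatching n h ∧ IsSupportedOn h S ∧ S ∈ congruenceOrbit X := by
  classical
  obtain ⟨S, hS, hc⟩ := exists_forall_isCleanRow hX
  have hsS := transpose_eq_neg_of_mem_congruenceOrbit hS hX
  let h : ℕ → ℕ := fun i =>
    if hi : ∃ j : Fin n, ∃ hi : i < n, S ⟨i, hi⟩ j ≠ 0 then (hi.choose : ℕ) else n
  have hsupp : IsSupportedOn h S := by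
    intro i j
    by_cases hi : ∃ j : Fin n, ∃ hi : (i : ℕ) < n, S ⟨i, hi⟩ j ≠ 0
    · have e : h i = hi.choose := dif_pos hi
      obtain ⟨_, h2⟩ := hi.choose_spec
      rw [e, ← Fin.ext_iff]
      exact ⟨fun h3 => (hc i).1 _ _ h2 h3, fun h3 => h3 ▸ h2⟩
    · have e : h i = n := dif_neg hi
      rw [e]
      exact ⟨fun h3 => absurd ⟨j, i.2, h3⟩ hi, fun h3 => absurd h3 j.2.ne'⟩
  refine ⟨h, S, ⟨fun i hi => ⟨?_, fun hii => ?_⟩, fun i hi j hj hij => ?_⟩, hsupp, hS⟩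
  · simp only [h]
    split_ifs with h1
    · exact h1.choose.2.le
    · exact le_rfl
  · exact (hsupp ⟨i, hi⟩ ⟨i, hi⟩).2 hii (apply_self_of_skew hsS _)
  · have h1 := (hsupp ⟨i, hi⟩ ⟨j, hj⟩).2 hij
    rw [apply_swap_of_skew hsS, neg_ne_zero] at h1
    exact (hsupp _ _).1 h1

/-! ### Induction on the counts and conclusion -/

/-- The order on counts implies degeneration of matrices supported on matchings. -/
theorem mem_closure_of_matchCount_le {n : ℕ} {x : ℕ → ℕ} (hx : IsMatching n x)
    {X : Matrix (Fin n) (Fin n) ℂ} (hX : IsSupportedOn x X) (hsX : X.transpose = -X) (N : ℕ) :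
    ∀ {y : ℕ → ℕ} {Y : Matrix (Fin n) (Fin n) ℂ}, IsMatching n y → IsSupportedOn y Y →
      Y.transpose = -Y → (∀ k < n, ∀ l < n, matchCount x k l ≤ matchCount y k l) →
      ∑ k ∈ Finset.range n, ∑ l ∈ Finset.range n, matchCount y k l = N →
      X ∈ closure (congruenceOrbit Y) := by
  induction N using Nat.strong_induction_on with
  | _ N ih =>
    intro y Y hy hY hsY hle hN
    by_cases hne : ∃ i < n, x i ≠ y i
    · obtain ⟨p, a, c, d, hE, hdef⟩ := exists_isExchange hx hy hle hne
      obtain ⟨Y', hsY', hY', hcl⟩ := hE.exists_mem_closure hy hY hsY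
      refine mem_closure_congruenceOrbit_trans
        (ih (∑ k ∈ Finset.range n, ∑ l ∈ Finset.range n, matchCount (exchange y p a c d) k l) ?_
          (hE.isMatching hy) hY' hsY' ?_ rfl) hcl
      · have h1 := hE.p_lt_a
        have h2 := hE.a_lt_c
        have h3 := hE.c_le
        have h4 := hE.p_lt_d
        have hmono : ∀ k ∈ Finset.range n, ∀ l ∈ Finset.range n,
            matchCount (exchange y p a c d) k l ≤ matchCount y k l := by
          intro k hk l _
          have := hE.matchCount_eq hy (l := l) (Finset.mem_range.1 hk)
          omega
        rw [← hN]
        -- The sum drops strictly because the defect is positive at (p, a).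
        refine Finset.sum_lt_sum (fun k hk => Finset.sum_le_sum (hmono k hk))
          ⟨p, Finset.mem_range.2 (by omega), Finset.sum_lt_sum
            (hmono p (Finset.mem_range.2 (by omega))) ⟨a, Finset.mem_range.2 (by omega), ?_⟩⟩
        rw [hE.matchCount_eq hy (show p < n by omega)]
        unfold exchangeDefect
        rw [if_pos ⟨le_rfl, h4, le_rfl, h2⟩]
        omega
      · intro k hk l hl
        have e1 := hdef k hk l hl
        rw [hE.matchCount_eq hy hk] at e1
        omega
    · push Not at hne
      apply subset_closure
      refine IsSupportedOn.mem_congruenceOrbit hy hY (fun i j => ?_) hsY hsX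
      rw [hX i j, hne i i.2]

theorem mainTheorem4 (n : ℕ) (X Y : Matrix (Fin n) (Fin n) ℂ)
    (hX : X.transpose = -X) (hY : Y.transpose = -Y) :
    closureLE (congruenceOrbit X) (congruenceOrbit Y) ↔
      entrywiseLE (rankControl X) (rankControl Y) := by
  constructor
  · intro h k l
    obtain ⟨S, hS, hle⟩ := exists_rank_submatrix_le_of_mem_closure (h (mem_congruenceOrbit_self X))
      (Fin.castLE (Nat.succ_le_of_lt k.isLt)) (Fin.castLE (Nat.succ_le_of_lt l.isLt))
    exact hle.trans (rankControl_le_of_mem_congruenceOrbit hS k l)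
  · intro h
    obtain ⟨x, X', hx, hX', hXX'⟩ := exists_isSupportedOn hX
    obtain ⟨y, Y', hy, hY', hYY'⟩ := exists_isSupportedOn hY
    have hle : ∀ k < n, ∀ l < n, matchCount x k l ≤ matchCount y k l := by
      intro k hk l hl
      have e1 := hX'.rankControl_eq hx ⟨k, hk⟩ ⟨l, hl⟩
      have e2 := hY'.rankControl_eq hy ⟨k, hk⟩ ⟨l, hl⟩
      have e3 := rankControl_le_of_mem_congruenceOrbit hXX' ⟨k, hk⟩ ⟨l, hl⟩
      have e4 := rankControl_le_of_mem_congruenceOrbit (mem_congruenceOrbit_symm hYY')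
        ⟨k, hk⟩ ⟨l, hl⟩
      have e5 := h ⟨k, hk⟩ ⟨l, hl⟩
      rw [e1] at e3
      rw [e2] at e4
      exact e3.trans (e5.trans e4)
    have key := mem_closure_of_matchCount_le hx hX'
      (transpose_eq_neg_of_mem_congruenceOrbit hXX' hX) _ hy hY'
      (transpose_eq_neg_of_mem_congruenceOrbit hYY' hY) hle rfl
    intro S hS
    apply closure_subset_matrixZariskiClosure
    exact mem_closure_congruenceOrbit_trans
      (subset_closure (mem_congruenceOrbit_trans hS (mem_congruenceOrbit_symm hXX')))
      (mem_closure_congruenceOrbit_trans key (subset_closure hYY'))
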